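/- Let $n,N,L$ be natural numbers, $A\in\mathbb{C}^{n\times N}$ with columns $a_1,\dots,a_N$, and let $S\subset\{1,\dots,N\}$ have cardinality $k$. Let $A_S\in\mathbb{C}^{n\times k}$ be the submatrix of the columns of $A$ indexed by $S$; assume that these columns are linearly independent, and put $A_S^\dagger=(A_S^*A_S)^{-1}A_S^*$. Let $0<\alpha<1$ and suppose that $$\|A_S^\dagger a_\ell\|_2\le\alpha\qquad\text{for all }\ell\notin S.$$ Let $\Sigma=\operatorname{diag}(\sigma_j,\,j\in S)$ be a real diagonal matrix, deterministic or random (and then not necessarily independent of the matrix $\Phi$ below), with (almost surely) positive diagonal entries. Let $X$ be the random $N\times L$ matrix whose rows indexed by $S$ form the $k\times L$ matrix $X^S=\Sigma\Phi$ and whose other rows are zero. For a matrix $Z\in\mathbb{C}^{N\times L}$ with rows $Z^1,\dots,Z^N$ let $\|Z\|_{2,1}=\sum_{j=1}^N\|Z^j\|_2$. We say that $\ell_{2,1}$-minimization recovers $X$ if $X$ is the unique solution of $$\min_{Z\in\mathbb{C}^{N\times L}}\|Z\|_{2,1}\quad\text{subject to}\quad AZ=AX.$$ (a) Suppose that the entries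 of $\Phi\in\mathbb{R}^{k\times L}$ are independent standard normal variables, or that the rows of $\Phi\in\mathbb{R}^{k\times L}$ are independent and uniformly distributed on the unit sphere of $\mathbb{R}^L$. Then $\ell_{2,1}$-minimization recovers $X$ with probability at least $$1-N\exp\Bigl(-\tfrac{L}{2}\bigl(\alpha^{-2}-\log(\alpha^{-2})-1\bigr)\Bigr).$$ (b) Suppose that the real and imaginary parts of the entries of $\Phi\in\mathbb{C}^{k\times L}$ are independent standard normal variables, or that the rows of $\Phi\in\mathbb{C}^{k\times L}$ are independent and uniformly distributed on the unit sphere of $\mathbb{C}^L$. Then $\ell_{2,1}$-minimization recovers $X$ with probability at least $$1-N\exp\Bigl(-L\bigl(\alpha^{-2}-\log(\alpha^{-2})-1\bigr)\Bigr).$$ -/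

import Mathlib

open MeasureTheory ProbabilityTheory

noncomputable section

/-- The submatrix `A_S` of the columns of `A` indexed by `S`. -/
def colSubmatrix {n N : ℕ} (A : Matrix (Fin n) (Fin N) ℂ) (S : Finset (Fin N)) :
    Matrix (Fin n) S ℂ :=
  A.submatrix id (fun j => (j : Fin N))

/-- The pseudo-inverse `B^† = (B^* B)⁻¹ B^*` of a matrix `B` with linearly independent columns. -/
def pinv {m κ : Type*} [Fintype m] [Fintype κ] [DecidableEq κ] (B : Matrix m κ ℂ) :
    Matrix κ m ℂ :=
  (B.conjTranspose * B)⁻¹ * B.conjTranspose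

/-- The mixed norm `‖X‖_{2,1}`: the sum of the Euclidean norms of the rows of `X`. -/
def norm21 {N L : ℕ} (X : Matrix (Fin N) (Fin L) ℂ) : ℝ :=
  ∑ j, ‖WithLp.toLp 2 (X j)‖

/-- `X` is a solution of the program `min ‖X‖_{2,1}` subject to `A X = Y`. -/
def IsL21Solution {n N L : ℕ} (A : Matrix (Fin n) (Fin N) ℂ) (Y : Matrix (Fin n) (Fin L) ℂ)
    (X : Matrix (Fin N) (Fin L) ℂ) : Prop :=
  A * X = Y ∧ ∀ X' : Matrix (Fin N) (Fin L) ℂ, A * X' = Y → norm21 X ≤ norm21 X'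

/-- `ℓ_{2,1}`-minimization recovers `X` from `Y = A X`: the matrix `X` is the one and only
solution of the program with data `Y = A X`. -/
def L21Recovers {n N L : ℕ} (A : Matrix (Fin n) (Fin N) ℂ) (X : Matrix (Fin N) (Fin L) ℂ) :
    Prop :=
  ∀ X' : Matrix (Fin N) (Fin L) ℂ, IsL21Solution A (A * X) X' ↔ X' = X

/-- The `N × L` matrix whose rows indexed by `S` are those of `M`, all other rows being zero. -/
def extendRows {N L : ℕ} (S : Finset (Fin N)) (M : Matrix S (Fin L) ℂ) :
    Matrix (Fin N) (Fin L) ℂ :=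
  Matrix.of fun i l => if h : i ∈ S then M ⟨i, h⟩ l else 0

/-- The uniform probability distribution on the unit sphere of a finite-dimensional real inner
product space `E ≠ 0`, as a measure on `E`: normalized surface measure. -/
def uniformSphere (E : Type*) [NormedAddCommGroup E] [InnerProductSpace ℝ E]
    [FiniteDimensional ℝ E] [MeasurableSpace E] [BorelSpace E] : Measure E :=
  (((volume : Measure E).toSphere Set.univ)⁻¹ • (volume : Measure E).toSphere).map
    (fun x : Metric.sphere (0 : E) 1 => (x : E))

variable {Ω : Type*} [MeasurableSpace Ω]

/-- Real Gaussian model: the entries of `Φ` are independent standard normal variables. -/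
def IsRealGaussian {κ : Type*} {L : ℕ} (Φ : Ω → Matrix κ (Fin L) ℝ) (μ : Measure Ω) : Prop :=
  (∀ p : κ × Fin L, HasLaw (fun ω => Φ ω p.1 p.2) (gaussianReal 0 1) μ) ∧
    iIndepFun (fun (p : κ × Fin L) ω => Φ ω p.1 p.2) μ

/-- Real spherical model: the rows of `Φ` are independent and uniformly distributed on the unit
sphere of `ℝ^L`. -/
def IsRealSpherical {κ : Type*} {L : ℕ} (Φ : Ω → Matrix κ (Fin L) ℝ) (μ : Measure Ω) : Prop :=
  (∀ j : κ, HasLaw (fun ω => WithLp.toLp 2 (Φ ω j))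
      (uniformSphere (EuclideanSpace ℝ (Fin L))) μ) ∧
    iIndepFun (fun (j : κ) ω => (WithLp.toLp 2 (Φ ω j) : EuclideanSpace ℝ (Fin L))) μ

/-- Complex Gaussian model: the real and imaginary parts of all entries of `Φ` are independent
standard normal variables. -/
def IsComplexGaussian {κ : Type*} {L : ℕ} (Φ : Ω → Matrix κ (Fin L) ℂ) (μ : Measure Ω) : Prop :=
  (∀ p : κ × Fin L, HasLaw (fun ω => (Φ ω p.1 p.2).re) (gaussianReal 0 1) μ ∧
      HasLaw (fun ω => (Φ ω p.1 p.2).im) (gaussianReal 0 1) μ) ∧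
    iIndepFun (Sum.elim (fun (p : κ × Fin L) ω => (Φ ω p.1 p.2).re)
      (fun (p : κ × Fin L) ω => (Φ ω p.1 p.2).im)) μ

/-- Complex spherical model: the rows of `Φ` are independent and uniformly distributed on the unit
sphere of `ℂ^L` (the unit sphere of the underlying real Euclidean space of dimension `2 L`). -/
def IsComplexSpherical {κ : Type*} {L : ℕ} (Φ : Ω → Matrix κ (Fin L) ℂ) (μ : Measure Ω) : Prop :=
  (∀ j : κ, HasLaw (fun ω => WithLp.toLp 2 (Φ ω j))
      (uniformSphere (EuclideanSpace ℂ (Fin L))) μ) ∧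
    iIndepFun (fun (j : κ) ω => (WithLp.toLp 2 (Φ ω j) : EuclideanSpace ℂ (Fin L))) μ

end

/-!
Let `u j` be the direction of row `j` of `Φ`; the positive scaling `Σ` does not change it. By the
dual certificate `j ↦ u j`, recovery holds once `‖∑ j, conj (b j) • u j‖ < 1` for each `ℓ ∉ S`,
where `b = A_S^† a_ℓ` satisfies `‖b‖ ≤ α`.

The law of each row is rotation invariant, hence so is that of its direction. Let `u` be such a
direction in real dimension `d`, and `g` an independent standard Gaussian vector. Since
`s ↦ cosh √s` is convex and `E ‖g‖² = d`, Jensen's inequality and rotation invariance give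
`E exp ⟪u, h⟫ = E cosh ⟪u, h⟫ ≤ E cosh (‖g‖ ⟪u, h⟫ / √d) = E exp (‖h‖ ⟪u, g⟫ / √d)`,
and the right-hand side is at most `exp (‖h‖² / (2 d))` because `‖u‖ ≤ 1`: the vector `u` is
sub-Gaussian with variance proxy `1 / d`.

So `W = ∑ j, conj (b j) • u j` has variance proxy `α² / d`, and integrating `exp ⟪W, √(2θ) g⟫` in
both orders gives `E exp (θ ‖W‖²) ≤ (1 - 2 θ α² / d) ^ (-d / 2)`. For real rows and complex
coefficients `d = L`, not `2 L`, and Hölder's inequality combines the real and the imaginary part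
of `W`, which are dependent. The optimal Chernoff bound and a union bound over `ℓ` conclude.
-/

section Integral

open scoped ENNReal

variable {Ω : Type*} [MeasurableSpace Ω] {μ : Measure Ω} {f : Ω → ℝ}

lemma lintegral_ofReal_le_ofReal_iff {C : ℝ} (hf : AEStronglyMeasurable f μ) (hf0 : 0 ≤ᵐ[μ] f)
    (hC : 0 ≤ C) :
    ∫⁻ ω, ENNReal.ofReal (f ω) ∂μ ≤ ENNReal.ofReal C ↔ Integrable f μ ∧ ∫ ω, f ω ∂μ ≤ C := by
  constructor
  · intro h
    have hint : Integrable f μ :=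
      (lintegral_ofReal_ne_top_iff_integrable hf hf0).1
        (ne_top_of_le_ne_top ENNReal.ofReal_ne_top h)
    rw [← ofReal_integral_eq_lintegral_ofReal hint hf0] at h
    exact ⟨hint, (ENNReal.ofReal_le_ofReal_iff hC).1 h⟩
  · rintro ⟨hint, h⟩
    rw [← ofReal_integral_eq_lintegral_ofReal hint hf0]
    exact ENNReal.ofReal_le_ofReal h

lemma ofReal_map_integral_le_lintegral_of_convexOn [IsProbabilityMeasure μ] {s : Set ℝ} {φ : ℝ → ℝ}
    (hφ : ConvexOn ℝ s φ) (hφc : ContinuousOn φ s) (hs : IsClosed s)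
    (hφ0 : ∀ x ∈ s, 0 ≤ φ x) (hfs : ∀ᵐ ω ∂μ, f ω ∈ s) (hf : Integrable f μ)
    (hφf : AEStronglyMeasurable (φ ∘ f) μ) :
    ENNReal.ofReal (φ (∫ ω, f ω ∂μ)) ≤ ∫⁻ ω, ENNReal.ofReal (φ (f ω)) ∂μ := by
  have hφf0 : 0 ≤ᵐ[μ] φ ∘ f := hfs.mono fun ω hω => hφ0 _ hω
  by_cases h : ∫⁻ ω, ENNReal.ofReal (φ (f ω)) ∂μ = ∞
  · rw [h]
    exact le_top
  · have hint : Integrable (φ ∘ f) μ := (lintegral_ofReal_ne_top_iff_integrable hφf hφf0).1 h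
    have hlint := ofReal_integral_eq_lintegral_ofReal hint hφf0
    simp only [Function.comp_apply] at hlint
    rw [← hlint]
    exact ENNReal.ofReal_le_ofReal (hφ.map_integral_le hφc hs hfs hf hint)

lemma lintegral_exp_convex_combination_le {g : Ω → ℝ} {C : ℝ≥0∞} {p q : ℝ}
    (hf : AEMeasurable f μ) (hg : AEMeasurable g μ) (hp : 0 ≤ p) (hq : 0 ≤ q) (hpq : p + q = 1)
    (hfC : ∫⁻ ω, ENNReal.ofReal (Real.exp (f ω)) ∂μ ≤ C)
    (hgC : ∫⁻ ω, ENNReal.ofReal (Real.exp (g ω)) ∂μ ≤ C) :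
    ∫⁻ ω, ENNReal.ofReal (Real.exp (p * f ω + q * g ω)) ∂μ ≤ C := by
  have hsplit (ω : Ω) : ENNReal.ofReal (Real.exp (p * f ω + q * g ω))
      = ENNReal.ofReal (Real.exp (f ω)) ^ p * ENNReal.ofReal (Real.exp (g ω)) ^ q := by
    rw [ENNReal.ofReal_rpow_of_pos (Real.exp_pos _), ENNReal.ofReal_rpow_of_pos (Real.exp_pos _),
      ← ENNReal.ofReal_mul (by positivity), ← Real.exp_mul, ← Real.exp_mul, ← Real.exp_add,
      mul_comm p, mul_comm q]
  calc ∫⁻ ω, ENNReal.ofReal (Real.exp (p * f ω + q * g ω)) ∂μ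
      ≤ (∫⁻ ω, ENNReal.ofReal (Real.exp (f ω)) ∂μ) ^ p
          * (∫⁻ ω, ENNReal.ofReal (Real.exp (g ω)) ∂μ) ^ q := by
        simp_rw [hsplit]
        exact ENNReal.lintegral_mul_norm_pow_le (by fun_prop) (by fun_prop) hp hq hpq
    _ ≤ C ^ p * C ^ q := by gcongr
    _ = C := by rw [← ENNReal.rpow_add_of_nonneg _ _ hp hq, hpq, ENNReal.rpow_one]

end Integral

section Gaussian

open scoped ENNReal RealInnerProductSpace

variable {V : Type*} [NormedAddCommGroup V] [InnerProductSpace ℝ V] [FiniteDimensional ℝ V]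
  [MeasurableSpace V] [BorelSpace V]

lemma map_inner_stdGaussian (w : V) :
    (stdGaussian V).map (fun g => ⟪w, g⟫) = gaussianReal 0 (‖w‖₊ ^ 2) := by
  have h := IsGaussian.map_eq_gaussianReal (μ := stdGaussian V) (innerSL ℝ w)
  rwa [integral_strongDual_stdGaussian, variance_dual_stdGaussian, innerSL_apply_norm,
    Real.toNNReal_pow (norm_nonneg _), norm_toNNReal] at h

lemma lintegral_exp_inner_stdGaussian (w : V) :
    ∫⁻ g, ENNReal.ofReal (Real.exp ⟪w, g⟫) ∂(stdGaussian V)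
      = ENNReal.ofReal (Real.exp (‖w‖ ^ 2 / 2)) := by
  have hint : Integrable Real.exp (gaussianReal 0 (‖w‖₊ ^ 2)) := by
    simpa using integrable_exp_mul_gaussianReal (μ := 0) (v := ‖w‖₊ ^ 2) 1
  have hmgf : ∫ x, Real.exp x ∂(gaussianReal 0 (‖w‖₊ ^ 2)) = Real.exp (‖w‖ ^ 2 / 2) := by
    have h := congrFun (mgf_id_gaussianReal (μ := 0) (v := ‖w‖₊ ^ 2)) 1
    simp only [mgf, id_eq, one_mul] at h
    simp [h]
  rw [← lintegral_map (f := fun x : ℝ => ENNReal.ofReal (Real.exp x)) (g := fun g => ⟪w, g⟫)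
    (by fun_prop) (by fun_prop), map_inner_stdGaussian,
    ← ofReal_integral_eq_lintegral_ofReal hint (.of_forall fun x => (Real.exp_pos x).le), hmgf]

lemma lintegral_exp_mul_norm_sq_eq_lintegral_stdGaussian {Ω : Type*} [MeasurableSpace Ω]
    {μ : Measure Ω} [SFinite μ] {W : Ω → V} (hW : AEMeasurable W μ) (s : ℝ) :
    ∫⁻ ω, ENNReal.ofReal (Real.exp (s ^ 2 / 2 * ‖W ω‖ ^ 2)) ∂μ
      = ∫⁻ g, ∫⁻ ω, ENNReal.ofReal (Real.exp ⟪W ω, s • g⟫) ∂μ ∂(stdGaussian V) := by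
  calc ∫⁻ ω, ENNReal.ofReal (Real.exp (s ^ 2 / 2 * ‖W ω‖ ^ 2)) ∂μ
      = ∫⁻ ω, ∫⁻ g, ENNReal.ofReal (Real.exp ⟪s • W ω, g⟫) ∂(stdGaussian V) ∂μ := by
        refine lintegral_congr fun ω => ?_
        rw [lintegral_exp_inner_stdGaussian, norm_smul, mul_pow, Real.norm_eq_abs, sq_abs,
          mul_div_right_comm]
    _ = ∫⁻ g, ∫⁻ ω, ENNReal.ofReal (Real.exp ⟪s • W ω, g⟫) ∂μ ∂(stdGaussian V) := by
        have : AEMeasurable (fun p : Ω × V => W p.1) (μ.prod (stdGaussian V)) := hW.comp_fst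
        refine lintegral_lintegral_swap ?_
        unfold Function.uncurry
        fun_prop
    _ = ∫⁻ g, ∫⁻ ω, ENNReal.ofReal (Real.exp ⟪W ω, s • g⟫) ∂μ ∂(stdGaussian V) := by
        simp only [real_inner_smul_left, real_inner_smul_right]

lemma integrable_norm_sq_stdGaussian : Integrable (fun g : V => ‖g‖ ^ 2) (stdGaussian V) :=
  (IsGaussian.memLp_two_id (μ := stdGaussian V)).integrable_norm_pow two_ne_zero

lemma integral_inner_sq_stdGaussian (w : V) :
    ∫ g, ⟪w, g⟫ ^ 2 ∂(stdGaussian V) = ‖w‖ ^ 2 := by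
  have h := variance_dual_stdGaussian (innerSL ℝ w)
  rwa [variance_of_integral_eq_zero (by fun_prop) (integral_strongDual_stdGaussian _),
    innerSL_apply_norm] at h

lemma integral_norm_sq_stdGaussian :
    ∫ g : V, ‖g‖ ^ 2 ∂(stdGaussian V) = Module.finrank ℝ V := by
  have hint (w : V) : Integrable (fun g => ⟪w, g⟫ ^ 2) (stdGaussian V) := by
    refine (integrable_norm_sq_stdGaussian.const_mul (‖w‖ ^ 2)).mono' (by fun_prop)
      (.of_forall fun g => ?_)
    rw [Real.norm_eq_abs, abs_pow, ← mul_pow]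
    gcongr
    exact abs_real_inner_le_norm w g
  simp_rw [← (stdOrthonormalBasis ℝ V).sum_sq_inner_right]
  rw [integral_finsetSum _ fun i _ => hint _]
  simp only [integral_inner_sq_stdGaussian, OrthonormalBasis.norm_eq_one, one_pow,
    Finset.sum_const, Finset.card_univ, Fintype.card_fin, nsmul_eq_mul, mul_one]

lemma integral_exp_mul_sq_gaussianReal {c : ℝ} (hc : c < 1 / 2) :
    ∫ x, Real.exp (c * x ^ 2) ∂(gaussianReal 0 1) = (1 - 2 * c) ^ (-(1 / 2) : ℝ) := by
  have h0 : 0 < 1 - 2 * c := by linarith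
  have hdensity (x : ℝ) : gaussianPDFReal 0 1 x • Real.exp (c * x ^ 2)
      = (√(2 * Real.pi))⁻¹ * Real.exp (-((1 - 2 * c) / 2) * x ^ 2) := by
    rw [gaussianPDFReal, smul_eq_mul, mul_assoc, ← Real.exp_add]
    simp only [NNReal.coe_one, mul_one, sub_zero]
    ring_nf
  rw [integral_gaussianReal_eq_integral_smul one_ne_zero]
  simp_rw [hdensity]
  have := Real.pi_pos
  rw [integral_const_mul, integral_gaussian, Real.rpow_neg h0.le, ← Real.sqrt_eq_rpow,
    ← Real.sqrt_inv, ← Real.sqrt_inv, ← Real.sqrt_mul (by positivity)]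
  congr 1
  field_simp

lemma integrable_exp_mul_sq_gaussianReal {c : ℝ} (hc : c < 1 / 2) :
    Integrable (fun x => Real.exp (c * x ^ 2)) (gaussianReal 0 1) := by
  refine Integrable.of_integral_ne_zero ?_
  rw [integral_exp_mul_sq_gaussianReal hc]
  have h0 : 0 < 1 - 2 * c := by linarith
  positivity

lemma lintegral_exp_mul_norm_sq_stdGaussian {c : ℝ} (hc : c < 1 / 2) :
    ∫⁻ g : V, ENNReal.ofReal (Real.exp (c * ‖g‖ ^ 2)) ∂(stdGaussian V)
      = ENNReal.ofReal ((1 - 2 * c) ^ (-(Module.finrank ℝ V / 2) : ℝ)) := by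
  have h0 : 0 < 1 - 2 * c := by linarith
  have hcoord (x : Fin (Module.finrank ℝ V) → ℝ) :
      Real.exp (c * ‖∑ i, x i • stdOrthonormalBasis ℝ V i‖ ^ 2)
        = ∏ i, Real.exp (c * x i ^ 2) := by
    rw [← Real.exp_sum, ← Finset.mul_sum, ← (stdOrthonormalBasis ℝ V).sum_sq_inner_right]
    simp only [(stdOrthonormalBasis ℝ V).orthonormal.inner_right_fintype]
  rw [stdGaussian, lintegral_map (by fun_prop) (by fun_prop)]
  simp_rw [hcoord]
  rw [← ofReal_integral_eq_lintegral_ofReal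
      (Integrable.fintype_prod fun _ => integrable_exp_mul_sq_gaussianReal hc)
      (.of_forall fun x => Finset.prod_nonneg fun i _ => (Real.exp_pos _).le),
    integral_fintype_prod_eq_prod (f := fun _ x => Real.exp (c * x ^ 2))]
  simp only [integral_exp_mul_sq_gaussianReal hc, Finset.prod_const, Finset.card_univ,
    Fintype.card_fin]
  rw [← Real.rpow_mul_natCast h0.le]
  ring_nf

end Gaussian

section SubgaussianVector

open scoped ENNReal NNReal RealInnerProductSpace

variable {Ω : Type*} [MeasurableSpace Ω] {μ : Measure Ω}
  {V : Type*} [NormedAddCommGroup V] [InnerProductSpace ℝ V]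

/-- A random vector `W` is sub-Gaussian with variance proxy `v` if each marginal `⟪W, h⟫` is
sub-Gaussian with variance proxy `v ‖h‖²`. The bound is on the moment
generating function of `W` itself, so `W` is centered when `μ` is a probability measure. -/
def IsSubgaussianVector (W : Ω → V) (v : ℝ≥0) (μ : Measure Ω) : Prop :=
  ∀ h : V, HasSubgaussianMGF (fun ω => ⟪W ω, h⟫) (v * ‖h‖₊ ^ 2) μ

namespace IsSubgaussianVector

variable {W : Ω → V} {v : ℝ≥0}

lemma mono {v' : ℝ≥0} (hW : IsSubgaussianVector W v μ) (hv : v ≤ v') :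
    IsSubgaussianVector W v' μ := fun h =>
  { integrable_exp_mul := (hW h).integrable_exp_mul
    mgf_le := fun t => ((hW h).mgf_le t).trans (by gcongr) }

lemma clm_comp {V' : Type*} [NormedAddCommGroup V'] [InnerProductSpace ℝ V'] [CompleteSpace V]
    [CompleteSpace V'] (hW : IsSubgaussianVector W v μ) (T : V →L[ℝ] V') :
    IsSubgaussianVector (fun ω => T (W ω)) (v * ‖T‖₊ ^ 2) μ := by
  intro h
  simp only [← ContinuousLinearMap.adjoint_inner_right]
  have hnorm : ‖T.adjoint h‖₊ ≤ ‖T‖₊ * ‖h‖₊ :=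
    (T.adjoint.le_opNNNorm h).trans_eq (by rw [LinearIsometryEquiv.nnnorm_map])
  refine { integrable_exp_mul := (hW _).integrable_exp_mul
           mgf_le := fun t => ((hW _).mgf_le t).trans ?_ }
  rw [mul_assoc v, ← mul_pow]
  gcongr

lemma const_smul {𝕜 : Type*} [NormedField 𝕜] [NormedSpace 𝕜 V] [SMulCommClass ℝ 𝕜 V]
    [CompleteSpace V] (hW : IsSubgaussianVector W v μ) (b : 𝕜) :
    IsSubgaussianVector (fun ω => b • W ω) (v * ‖b‖₊ ^ 2) μ := by
  refine (hW.clm_comp (b • ContinuousLinearMap.id ℝ V)).mono ?_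
  gcongr
  exact ContinuousLinearMap.opNNNorm_le_bound _ _ fun x => (nnnorm_smul b x).le

lemma sum [MeasurableSpace V] [OpensMeasurableSpace V] {κ : Type*} [Fintype κ]
    {W : κ → Ω → V} {v : κ → ℝ≥0} (hW : ∀ j, IsSubgaussianVector (W j) (v j) μ)
    (hind : iIndepFun W μ) :
    IsSubgaussianVector (fun ω => ∑ j, W j ω) (∑ j, v j) μ := by
  intro h
  simp only [sum_inner, Finset.sum_mul]
  exact HasSubgaussianMGF.sum_of_iIndepFun
    (hind.comp (fun _ w => ⟪w, h⟫) fun _ => by fun_prop) fun j _ => hW j h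

variable [FiniteDimensional ℝ V]

lemma ae_eq_zero (hW : IsSubgaussianVector W 0 μ) : W =ᵐ[μ] 0 := by
  refine ae_eq_zero_of_forall_inner (𝕜 := ℝ) fun h => ?_
  have hh := hW h
  rw [zero_mul] at hh
  filter_upwards [hh.ae_eq_zero_of_hasSubgaussianMGF_zero] with ω hω
  rw [real_inner_comm, hω]

variable [MeasurableSpace V] [BorelSpace V]

lemma aemeasurable (hW : IsSubgaussianVector W v μ) : AEMeasurable W μ := by
  have hcoord : W = fun ω => ∑ i, ⟪W ω, stdOrthonormalBasis ℝ V i⟫ • stdOrthonormalBasis ℝ V i := by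
    ext1 ω
    simpa only [real_inner_comm] using ((stdOrthonormalBasis ℝ V).sum_repr' (W ω)).symm
  rw [hcoord]
  exact Finset.aemeasurable_fun_sum _ fun i _ => (hW _).aemeasurable.smul_const _

lemma lintegral_exp_inner_le (hW : IsSubgaussianVector W v μ) (h : V) :
    ∫⁻ ω, ENNReal.ofReal (Real.exp ⟪W ω, h⟫) ∂μ
      ≤ ENNReal.ofReal (Real.exp (v * ‖h‖ ^ 2 / 2)) := by
  have hWm := hW.aemeasurable
  refine (lintegral_ofReal_le_ofReal_iff (by fun_prop) (.of_forall fun ω => (Real.exp_pos _).le)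
    (Real.exp_pos _).le).2 ⟨?_, ?_⟩
  · simpa only [one_mul] using (hW h).integrable_exp_mul 1
  · simpa [mgf] using (hW h).mgf_le 1

lemma of_lintegral_exp_inner_le (hW : AEMeasurable W μ)
    (hle : ∀ h, ∫⁻ ω, ENNReal.ofReal (Real.exp ⟪W ω, h⟫) ∂μ
      ≤ ENNReal.ofReal (Real.exp (v * ‖h‖ ^ 2 / 2))) :
    IsSubgaussianVector W v μ := by
  intro h
  have hexp (t : ℝ) := (lintegral_ofReal_le_ofReal_iff (by fun_prop)
    (.of_forall fun ω => (Real.exp_pos _).le) (Real.exp_pos _).le).1 (hle (t • h))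
  simp only [real_inner_smul_right] at hexp
  refine { integrable_exp_mul := fun t => (hexp t).1, mgf_le := fun t => ?_ }
  refine (hexp t).2.trans_eq ?_
  simp only [norm_smul, mul_pow, Real.norm_eq_abs, sq_abs, NNReal.coe_mul, NNReal.coe_pow,
    coe_nnnorm]
  ring_nf

lemma lintegral_exp_mul_norm_sq_le [SFinite μ] (hW : IsSubgaussianVector W v μ) {θ : ℝ}
    (hθ : 0 ≤ θ) (hθv : 2 * θ * v < 1) :
    ∫⁻ ω, ENNReal.ofReal (Real.exp (θ * ‖W ω‖ ^ 2)) ∂μ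
      ≤ ENNReal.ofReal ((1 - 2 * θ * v) ^ (-(Module.finrank ℝ V / 2) : ℝ)) := by
  have hsq : √(2 * θ) ^ 2 = 2 * θ := Real.sq_sqrt (by positivity)
  calc ∫⁻ ω, ENNReal.ofReal (Real.exp (θ * ‖W ω‖ ^ 2)) ∂μ
      = ∫⁻ g, ∫⁻ ω, ENNReal.ofReal (Real.exp ⟪W ω, √(2 * θ) • g⟫) ∂μ ∂(stdGaussian V) := by
        rw [← lintegral_exp_mul_norm_sq_eq_lintegral_stdGaussian hW.aemeasurable, hsq,
          mul_div_cancel_left₀ _ two_ne_zero]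
    _ ≤ ∫⁻ g : V, ENNReal.ofReal (Real.exp (θ * v * ‖g‖ ^ 2)) ∂(stdGaussian V) := by
        refine lintegral_mono fun g => (hW.lintegral_exp_inner_le _).trans_eq ?_
        rw [norm_smul, mul_pow, Real.norm_eq_abs, sq_abs, hsq]
        ring_nf
    _ = ENNReal.ofReal ((1 - 2 * θ * v) ^ (-(Module.finrank ℝ V / 2) : ℝ)) := by
        rw [lintegral_exp_mul_norm_sq_stdGaussian (by linarith), mul_assoc]

lemma lintegral_exp_mul_norm_sq_add_le [SFinite μ] {W' : Ω → V} {v' : ℝ≥0}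
    (hW : IsSubgaussianVector W v μ) (hW' : IsSubgaussianVector W' v' μ) {θ : ℝ} (hθ : 0 ≤ θ)
    (hθv : 2 * θ * (v + v') < 1) :
    ∫⁻ ω, ENNReal.ofReal (Real.exp (θ * (‖W ω‖ ^ 2 + ‖W' ω‖ ^ 2))) ∂μ
      ≤ ENNReal.ofReal ((1 - 2 * θ * (v + v')) ^ (-(Module.finrank ℝ V / 2) : ℝ)) := by
  rcases eq_zero_or_pos v with rfl | hv
  · have hzero := lintegral_congr_ae (hW.ae_eq_zero.mono fun ω hω =>
      show ENNReal.ofReal (Real.exp (θ * (‖W ω‖ ^ 2 + ‖W' ω‖ ^ 2)))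
        = ENNReal.ofReal (Real.exp (θ * ‖W' ω‖ ^ 2)) by simp [hω])
    rw [hzero]
    simpa using hW'.lintegral_exp_mul_norm_sq_le hθ (by simpa using hθv)
  rcases eq_zero_or_pos v' with rfl | hv'
  · have hzero := lintegral_congr_ae (hW'.ae_eq_zero.mono fun ω hω =>
      show ENNReal.ofReal (Real.exp (θ * (‖W ω‖ ^ 2 + ‖W' ω‖ ^ 2)))
        = ENNReal.ofReal (Real.exp (θ * ‖W ω‖ ^ 2)) by simp [hω])
    rw [hzero]
    simpa using hW.lintegral_exp_mul_norm_sq_le hθ (by simpa using hθv)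
  -- Hölder exponents inversely proportional to the proxies give both factors the same bound.
  have hpq : (v / (v + v') + v' / (v + v') : ℝ) = 1 := by rw [← add_div, div_self (by positivity)]
  have hproxy (x : ℝ≥0) (hx : 0 < x) :
      2 * (θ / (x / (v + v'))) * x = 2 * θ * (v + v') := by field_simp
  have hbound := hW.lintegral_exp_mul_norm_sq_le (θ := θ / (v / (v + v'))) (by positivity)
    (by rwa [hproxy v hv])
  have hbound' := hW'.lintegral_exp_mul_norm_sq_le (θ := θ / (v' / (v + v'))) (by positivity)
    (by rwa [hproxy v' hv'])
  rw [hproxy v hv] at hbound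
  rw [hproxy v' hv'] at hbound'
  have hWm := hW.aemeasurable
  have hWm' := hW'.aemeasurable
  refine le_of_eq_of_le (lintegral_congr fun ω => ?_) (lintegral_exp_convex_combination_le
    (by fun_prop) (by fun_prop) (by positivity) (by positivity) hpq hbound hbound')
  congr 2
  field_simp

end IsSubgaussianVector

lemma measureReal_ge_le_of_lintegral_exp_le [IsFiniteMeasure μ] {f : Ω → ℝ} {d v r : ℝ}
    (hf : AEMeasurable f μ) (hd : 0 < d) (hv : 0 < v) (hr : d * v ≤ r)
    (hexp : ∀ θ, 0 ≤ θ → 2 * θ * v < 1 → ∫⁻ ω, ENNReal.ofReal (Real.exp (θ * f ω)) ∂μ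
      ≤ ENNReal.ofReal ((1 - 2 * θ * v) ^ (-(d / 2)))) :
    μ.real {ω | r ≤ f ω} ≤ Real.exp (-(d / 2) * (r / (d * v) - Real.log (r / (d * v)) - 1)) := by
  have hdv : 0 < d * v := mul_pos hd hv
  have hr0 : 0 < r := hdv.trans_le hr
  -- the minimizer of `θ ↦ exp (-θ r) (1 - 2 θ v) ^ (-d / 2)`
  set θ := (1 - d * v / r) / (2 * v) with hθ_def
  have hθ : 0 ≤ θ := div_nonneg (sub_nonneg.2 ((div_le_one hr0).2 hr)) (by positivity)
  have hθv : 1 - 2 * θ * v = d * v / r := by rw [hθ_def]; field_simp; ring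
  have hθr : θ * r = d / 2 * (r / (d * v) - 1) := by rw [hθ_def]; field_simp
  have hquot : 0 < d * v / r := by positivity
  obtain ⟨hint, hmgf⟩ := (lintegral_ofReal_le_ofReal_iff (by fun_prop)
    (.of_forall fun ω => (Real.exp_pos _).le) (by rw [hθv]; positivity)).1
    (hexp θ hθ (by linarith))
  calc μ.real {ω | r ≤ f ω}
      ≤ Real.exp (-θ * r) * mgf f μ θ := measure_ge_le_exp_mul_mgf r hθ hint
    _ ≤ Real.exp (-θ * r) * (1 - 2 * θ * v) ^ (-(d / 2)) := by gcongr; exact hmgf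
    _ = Real.exp (-(d / 2) * (r / (d * v) - Real.log (r / (d * v)) - 1)) := by
        rw [hθv, Real.rpow_def_of_pos hquot, ← Real.exp_add, neg_mul, hθr,
          ← inv_div r (d * v), Real.log_inv]
        ring_nf

end SubgaussianVector

section CoshSqrt

open scoped RealInnerProductSpace

lemma hasSum_cosh_sqrt {s : ℝ} (hs : 0 ≤ s) :
    HasSum (fun n : ℕ => s ^ n / ((2 * n).factorial : ℝ)) (Real.cosh (√s)) := by
  simpa only [pow_mul, Real.sq_sqrt hs] using Real.hasSum_cosh (√s)

lemma convexOn_cosh_sqrt : ConvexOn ℝ (Set.Ici 0) (fun s : ℝ => Real.cosh (√s)) := by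
  refine ⟨convex_Ici 0, fun x hx y hy a b ha hb hab => ?_⟩
  refine hasSum_le (fun n => ?_) (hasSum_cosh_sqrt (convex_Ici 0 hx hy ha hb hab))
    (((hasSum_cosh_sqrt hx).const_smul a).add ((hasSum_cosh_sqrt hy).const_smul b))
  have hpow := (convexOn_pow (𝕜 := ℝ) n).2 hx hy ha hb hab
  simp only [smul_eq_mul] at hpow ⊢
  rw [← mul_div_assoc, ← mul_div_assoc, ← add_div]
  gcongr

lemma cosh_le_lintegral_cosh_stdGaussian {V : Type*} [NormedAddCommGroup V]
    [InnerProductSpace ℝ V] [FiniteDimensional ℝ V] [MeasurableSpace V] [BorelSpace V]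
    [Nontrivial V] (y : ℝ) :
    ENNReal.ofReal (Real.cosh y)
      ≤ ∫⁻ g : V, ENNReal.ofReal (Real.cosh (‖g‖ / √(Module.finrank ℝ V) * y))
          ∂(stdGaussian V) := by
  have hd : (0 : ℝ) < Module.finrank ℝ V := mod_cast Module.finrank_pos
  have hcont : Continuous fun s => Real.cosh (√s) := Real.continuous_cosh.comp Real.continuous_sqrt
  have hsqrt (g : V) : √(‖g‖ ^ 2 * (y ^ 2 / Module.finrank ℝ V))
      = |‖g‖ / √(Module.finrank ℝ V) * y| := by
    rw [← Real.sqrt_sq_eq_abs, mul_pow, div_pow, Real.sq_sqrt hd.le]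
    congr 1
    ring
  have hmean : √(∫ g : V, ‖g‖ ^ 2 * (y ^ 2 / Module.finrank ℝ V) ∂(stdGaussian V)) = |y| := by
    rw [integral_mul_const, integral_norm_sq_stdGaussian, mul_div_cancel₀ _ hd.ne',
      Real.sqrt_sq_eq_abs]
  have hjensen := ofReal_map_integral_le_lintegral_of_convexOn convexOn_cosh_sqrt
    hcont.continuousOn isClosed_Ici (fun _ _ => (Real.cosh_pos _).le)
    (.of_forall fun g : V => Set.mem_Ici.2 (by positivity))
    (integrable_norm_sq_stdGaussian.mul_const (y ^ 2 / Module.finrank ℝ V))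
    (hcont.comp (by fun_prop)).aestronglyMeasurable
  simpa only [hmean, hsqrt, Real.cosh_abs] using hjensen

end CoshSqrt

section Rotation

open scoped ENNReal NNReal RealInnerProductSpace

variable {V : Type*} [NormedAddCommGroup V] [InnerProductSpace ℝ V] [MeasurableSpace V]

/-- Invariance of a measure on an inner product space under its whole orthogonal group, reflections
included. This is the only property of the Gaussian and spherical laws that recovery uses. -/
def IsRotationInvariant (ν : Measure V) : Prop :=
  ∀ e : V ≃ₗᵢ[ℝ] V, ν.map e = ν

variable [FiniteDimensional ℝ V] [BorelSpace V]

namespace IsRotationInvariant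

variable {ν : Measure V}

lemma lintegral_exp_inner_congr (hν : IsRotationInvariant ν) {v w : V} (h : ‖v‖ = ‖w‖) :
    ∫⁻ z, ENNReal.ofReal (Real.exp ⟪z, v⟫) ∂ν = ∫⁻ z, ENNReal.ofReal (Real.exp ⟪z, w⟫) ∂ν := by
  obtain ⟨e, rfl⟩ : ∃ e : V ≃ₗᵢ[ℝ] V, e v = w := ⟨_, Submodule.reflection_sub h⟩
  conv_rhs => rw [← hν e, lintegral_map (by fun_prop) e.continuous.measurable]
  simp only [LinearIsometryEquiv.inner_map_map]

lemma lintegral_cosh_inner (hν : IsRotationInvariant ν) (v : V) :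
    ∫⁻ z, ENNReal.ofReal (Real.cosh ⟪z, v⟫) ∂ν = ∫⁻ z, ENNReal.ofReal (Real.exp ⟪z, v⟫) ∂ν := by
  have hcosh (z : V) : ENNReal.ofReal (Real.cosh ⟪z, v⟫)
      = (ENNReal.ofReal (Real.exp ⟪z, v⟫) + ENNReal.ofReal (Real.exp ⟪z, -v⟫)) / 2 := by
    rw [← ENNReal.ofReal_add (Real.exp_pos _).le (Real.exp_pos _).le, inner_neg_right,
      Real.cosh_eq, ENNReal.ofReal_div_of_pos two_pos, ENNReal.ofReal_ofNat]
  simp_rw [hcosh, div_eq_mul_inv]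
  rw [lintegral_mul_const _ (by fun_prop), lintegral_add_left (by fun_prop),
    hν.lintegral_exp_inner_congr (norm_neg v), ← div_eq_mul_inv, ENNReal.add_div,
    ENNReal.add_halves]

lemma lintegral_exp_inner_le_lintegral_stdGaussian [SFinite ν] [Nontrivial V]
    (hν : IsRotationInvariant ν) (h : V) :
    ∫⁻ z, ENNReal.ofReal (Real.exp ⟪z, h⟫) ∂ν
      ≤ ∫⁻ g : V, ∫⁻ z, ENNReal.ofReal (Real.exp ⟪z, (‖h‖ / √(Module.finrank ℝ V)) • g⟫) ∂ν
          ∂(stdGaussian V) := by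
  have : Measurable Real.cosh := Real.continuous_cosh.measurable
  calc ∫⁻ z, ENNReal.ofReal (Real.exp ⟪z, h⟫) ∂ν
      = ∫⁻ z, ENNReal.ofReal (Real.cosh ⟪z, h⟫) ∂ν := (hν.lintegral_cosh_inner h).symm
    _ ≤ ∫⁻ z, ∫⁻ g : V, ENNReal.ofReal (Real.cosh (‖g‖ / √(Module.finrank ℝ V) * ⟪z, h⟫))
          ∂(stdGaussian V) ∂ν :=
        lintegral_mono fun z => cosh_le_lintegral_cosh_stdGaussian _
    _ = ∫⁻ g : V, ∫⁻ z, ENNReal.ofReal (Real.cosh (‖g‖ / √(Module.finrank ℝ V) * ⟪z, h⟫)) ∂ν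
          ∂(stdGaussian V) :=
        lintegral_lintegral_swap (by unfold Function.uncurry; fun_prop)
    _ = ∫⁻ g : V, ∫⁻ z, ENNReal.ofReal (Real.exp ⟪z, (‖h‖ / √(Module.finrank ℝ V)) • g⟫) ∂ν
          ∂(stdGaussian V) := by
        refine lintegral_congr fun g => ?_
        simp only [← real_inner_smul_right]
        rw [hν.lintegral_cosh_inner]
        refine hν.lintegral_exp_inner_congr ?_
        rw [norm_smul, norm_smul, Real.norm_of_nonneg (by positivity),
          Real.norm_of_nonneg (by positivity), div_mul_eq_mul_div, div_mul_eq_mul_div, mul_comm]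

lemma isSubgaussianVector_id [IsProbabilityMeasure ν] (hν : IsRotationInvariant ν)
    (hball : ∀ᵐ z ∂ν, ‖z‖ ≤ 1) :
    IsSubgaussianVector id (Module.finrank ℝ V : ℝ≥0)⁻¹ ν := by
  refine .of_lintegral_exp_inner_le aemeasurable_id fun h => ?_
  simp only [id_eq, NNReal.coe_inv, NNReal.coe_natCast]
  cases subsingleton_or_nontrivial V
  · simp [Subsingleton.elim h 0]
  refine (hν.lintegral_exp_inner_le_lintegral_stdGaussian h).trans ?_
  rw [← lintegral_exp_mul_norm_sq_eq_lintegral_stdGaussian (W := fun z => z) aemeasurable_id]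
  calc ∫⁻ z, ENNReal.ofReal (Real.exp ((‖h‖ / √(Module.finrank ℝ V)) ^ 2 / 2 * ‖z‖ ^ 2)) ∂ν
      ≤ ∫⁻ _, ENNReal.ofReal (Real.exp ((Module.finrank ℝ V : ℝ)⁻¹ * ‖h‖ ^ 2 / 2)) ∂ν := by
        refine lintegral_mono_ae ?_
        filter_upwards [hball] with z hz
        rw [div_pow, Real.sq_sqrt (Nat.cast_nonneg _), div_eq_inv_mul (‖h‖ ^ 2)]
        gcongr
        exact mul_le_of_le_one_right (by positivity) (pow_le_one₀ (norm_nonneg z) hz)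
    _ = ENNReal.ofReal (Real.exp ((Module.finrank ℝ V : ℝ)⁻¹ * ‖h‖ ^ 2 / 2)) := by simp

end IsRotationInvariant

lemma norm_normalize_le_one {E : Type*} [NormedAddCommGroup E] [NormedSpace ℝ E] (v : E) :
    ‖NormedSpace.normalize v‖ ≤ 1 := by
  rw [NormedSpace.normalize, norm_smul, norm_inv, norm_norm]
  exact inv_mul_le_one

@[fun_prop]
lemma measurable_normalize : Measurable (NormedSpace.normalize : V → V) := by
  unfold NormedSpace.normalize
  fun_prop

lemma normalize_linearIsometry {E F : Type*} [NormedAddCommGroup E] [NormedSpace ℝ E]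
    [NormedAddCommGroup F] [NormedSpace ℝ F] (e : E →ₗᵢ[ℝ] F) (v : E) :
    NormedSpace.normalize (e v) = e (NormedSpace.normalize v) := by
  rw [NormedSpace.normalize, NormedSpace.normalize, e.norm_map, map_smul]

lemma IsRotationInvariant.map_normalize {ν : Measure V} (hν : IsRotationInvariant ν) :
    IsRotationInvariant (ν.map NormedSpace.normalize) := by
  intro e
  conv_rhs => rw [← hν e]
  rw [Measure.map_map e.continuous.measurable measurable_normalize,
    Measure.map_map measurable_normalize e.continuous.measurable]
  congr 1
  ext1 v
  exact (normalize_linearIsometry e.toLinearIsometry v).symm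

variable {Ω : Type*} [MeasurableSpace Ω] {μ : Measure Ω}

lemma IsRotationInvariant.isSubgaussianVector_normalize [IsProbabilityMeasure μ] {R : Ω → V}
    (hR : AEMeasurable R μ) (hinv : IsRotationInvariant (μ.map R)) :
    IsSubgaussianVector (fun ω => NormedSpace.normalize (R ω)) (Module.finrank ℝ V : ℝ≥0)⁻¹ μ := by
  have hnR : AEMeasurable (fun ω => NormedSpace.normalize (R ω)) μ :=
    measurable_normalize.comp_aemeasurable hR
  have := Measure.isProbabilityMeasure_map hnR
  have hmap : (μ.map R).map NormedSpace.normalize = μ.map fun ω => NormedSpace.normalize (R ω) :=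
    AEMeasurable.map_map_of_aemeasurable measurable_normalize.aemeasurable hR
  have hball : ∀ᵐ z ∂(μ.map fun ω => NormedSpace.normalize (R ω)), ‖z‖ ≤ 1 :=
    (ae_map_iff hnR (measurableSet_le (by fun_prop) (by fun_prop))).2
      (.of_forall fun ω => norm_normalize_le_one _)
  intro h
  exact HasSubgaussianMGF.of_map (X := fun z => ⟪id z, h⟫) hnR
    ((hmap ▸ hinv.map_normalize).isSubgaussianVector_id hball h)

/-- Independent random vectors `R j`, each with a rotation invariant distribution: the common model
for the rows of a Gaussian or spherical random matrix. -/
structure IsRotationInvariantFamily {κ : Type*} (R : κ → Ω → V) (μ : Measure Ω) : Prop where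
  aemeasurable : ∀ j, AEMeasurable (R j) μ
  indep : iIndepFun R μ
  invariant : ∀ j, IsRotationInvariant (μ.map (R j))

namespace IsRotationInvariantFamily

variable {κ : Type*} [Fintype κ] {R : κ → Ω → V}

lemma isSubgaussianVector_sum_smul_normalize {𝕜 : Type*} [NormedField 𝕜]
    [NormedSpace 𝕜 V] [SMulCommClass ℝ 𝕜 V] (hR : IsRotationInvariantFamily R μ) (b : κ → 𝕜) :
    IsSubgaussianVector (fun ω => ∑ j, b j • NormedSpace.normalize (R j ω))
      ((Module.finrank ℝ V : ℝ≥0)⁻¹ * ∑ j, ‖b j‖₊ ^ 2) μ := by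
  have := hR.indep.isProbabilityMeasure
  rw [Finset.mul_sum]
  exact .sum (fun j => (IsRotationInvariant.isSubgaussianVector_normalize (hR.aemeasurable j)
    (hR.invariant j)).const_smul (b j))
    (hR.indep.comp (fun j v => b j • NormedSpace.normalize v) fun j =>
      measurable_normalize.const_smul (b j))

end IsRotationInvariantFamily

end Rotation

section Tail

open scoped ENNReal NNReal

/-- The isometric embedding of `ℝ^ι` in `ℂ^ι`, through which the rows of a real random matrix are
combined with complex coefficients. -/
def euclideanOfReal (ι : Type*) [Fintype ι] :
    EuclideanSpace ℝ ι →ₗᵢ[ℝ] EuclideanSpace ℂ ι where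
  toFun v := WithLp.toLp 2 fun i => (v i : ℂ)
  map_add' v w := by ext; simp
  map_smul' r v := by ext; simp
  norm_map' v := by simp [EuclideanSpace.norm_eq]

lemma norm_sum_smul_euclideanOfReal_sq {κ ι : Type*} [Fintype κ] [Fintype ι] (b : κ → ℂ)
    (v : κ → EuclideanSpace ℝ ι) :
    ‖∑ j, b j • euclideanOfReal ι (v j)‖ ^ 2
      = ‖∑ j, (b j).re • v j‖ ^ 2 + ‖∑ j, (b j).im • v j‖ ^ 2 := by
  rw [EuclideanSpace.norm_sq_eq, EuclideanSpace.norm_sq_eq, EuclideanSpace.norm_sq_eq,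
    ← Finset.sum_add_distrib]
  refine Finset.sum_congr rfl fun i _ => ?_
  rw [Complex.sq_norm, Complex.normSq_apply]
  simp [euclideanOfReal, sq]

namespace IsRotationInvariantFamily

variable {Ω : Type*} [MeasurableSpace Ω] {μ : Measure Ω} {κ : Type*} [Fintype κ] {α : ℝ}

lemma measureReal_one_le_norm_sum_smul_normalize_le {V : Type*} [NormedAddCommGroup V]
    [InnerProductSpace ℝ V] [FiniteDimensional ℝ V] [MeasurableSpace V] [BorelSpace V]
    {𝕜 : Type*} [NormedField 𝕜] [NormedSpace 𝕜 V] [SMulCommClass ℝ 𝕜 V] {R : κ → Ω → V}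
    (hR : IsRotationInvariantFamily R μ) (hα0 : 0 < α) (hα1 : α < 1) {b : κ → 𝕜}
    (hb : ∑ j, ‖b j‖ ^ 2 ≤ α ^ 2) :
    μ.real {ω | 1 ≤ ‖∑ j, b j • NormedSpace.normalize (R j ω)‖}
      ≤ Real.exp (-((Module.finrank ℝ V : ℝ) / 2)
          * ((α ^ 2)⁻¹ - Real.log ((α ^ 2)⁻¹) - 1)) := by
  have := hR.indep.isProbabilityMeasure
  lift α to ℝ≥0 using hα0.le
  rcases (Nat.cast_nonneg (α := ℝ) (Module.finrank ℝ V)).eq_or_lt with hd | hd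
  · simp [← hd]
  have hb' : ∑ j, ‖b j‖₊ ^ 2 ≤ α ^ 2 := by simpa [← NNReal.coe_le_coe] using hb
  have hsub := (hR.isSubgaussianVector_sum_smul_normalize b).mono (mul_le_mul_right hb' _)
  have hdv : (Module.finrank ℝ V : ℝ) * ((Module.finrank ℝ V : ℝ)⁻¹ * (α : ℝ) ^ 2)
      = (α : ℝ) ^ 2 := mul_inv_cancel_left₀ hd.ne' _
  have htail := measureReal_ge_le_of_lintegral_exp_le (r := 1) (hsub.aemeasurable.norm.pow_const 2)
    hd (mul_pos (inv_pos.2 hd) (pow_pos hα0 2)) (hdv.trans_le (pow_le_one₀ hα0.le hα1.le))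
    fun θ hθ hθv => hsub.lintegral_exp_mul_norm_sq_le hθ (mod_cast hθv)
  simpa only [hdv, one_div, one_le_sq_iff₀ (norm_nonneg _)] using htail

lemma measureReal_one_le_norm_sum_smul_euclideanOfReal_normalize_le {ι : Type*} [Fintype ι]
    {R : κ → Ω → EuclideanSpace ℝ ι} (hR : IsRotationInvariantFamily R μ) (hα0 : 0 < α)
    (hα1 : α < 1) {b : κ → ℂ} (hb : ∑ j, ‖b j‖ ^ 2 ≤ α ^ 2) :
    μ.real {ω | 1 ≤ ‖∑ j, b j • euclideanOfReal ι (NormedSpace.normalize (R j ω))‖}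
      ≤ Real.exp (-((Fintype.card ι : ℝ) / 2)
          * ((α ^ 2)⁻¹ - Real.log ((α ^ 2)⁻¹) - 1)) := by
  have := hR.indep.isProbabilityMeasure
  lift α to ℝ≥0 using hα0.le
  rw [← finrank_euclideanSpace (𝕜 := ℝ)]
  set d := Module.finrank ℝ (EuclideanSpace ℝ ι)
  rcases (Nat.cast_nonneg (α := ℝ) d).eq_or_lt with hd | hd
  · simp [← hd]
  have hb' : ∑ j, ‖(b j).re‖₊ ^ 2 + ∑ j, ‖(b j).im‖₊ ^ 2 ≤ α ^ 2 := by
    rw [← Finset.sum_add_distrib, ← NNReal.coe_le_coe]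
    push_cast
    simpa only [Complex.sq_norm, Complex.normSq_apply, ← sq, Real.norm_eq_abs, sq_abs] using hb
  have hre := hR.isSubgaussianVector_sum_smul_normalize fun j => (b j).re
  have him := (hR.isSubgaussianVector_sum_smul_normalize fun j => (b j).im).mono
    (mul_le_mul_right (le_tsub_of_add_le_left hb') _)
  have hv : ((d : ℝ≥0)⁻¹ * ∑ j, ‖(b j).re‖₊ ^ 2 : ℝ≥0)
      + ((d : ℝ≥0)⁻¹ * (α ^ 2 - ∑ j, ‖(b j).re‖₊ ^ 2) : ℝ≥0) = (d : ℝ)⁻¹ * (α : ℝ) ^ 2 := by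
    rw [← NNReal.coe_add, ← mul_add, add_tsub_cancel_of_le (le_of_add_le_left hb')]
    push_cast
    rfl
  have hdv : (d : ℝ) * ((d : ℝ)⁻¹ * (α : ℝ) ^ 2) = (α : ℝ) ^ 2 := mul_inv_cancel_left₀ hd.ne' _
  have htail := measureReal_ge_le_of_lintegral_exp_le (r := 1)
    ((hre.aemeasurable.norm.pow_const 2).add (him.aemeasurable.norm.pow_const 2))
    hd (mul_pos (inv_pos.2 hd) (pow_pos hα0 2)) (hdv.trans_le (pow_le_one₀ hα0.le hα1.le))
    fun θ hθ hθv => (hre.lintegral_exp_mul_norm_sq_add_le him hθ (by rwa [hv])).trans_eq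
      (by rw [hv])
  simpa only [hdv, one_div, Pi.add_apply, ← norm_sum_smul_euclideanOfReal_sq,
    one_le_sq_iff₀ (norm_nonneg _)] using htail

end IsRotationInvariantFamily

end Tail

section DualCertificate

open scoped InnerProductSpace

variable {𝕜 E : Type*} [RCLike 𝕜] [NormedAddCommGroup E] [InnerProductSpace 𝕜 E]

lemma neg_sum_re_inner_lt_sum_norm {ι κ : Type*} [Fintype κ] {s : Finset ι} {b : ι → κ → 𝕜}
    {u r : κ → E} {h : ι → E}
    (hr : ∀ j, r j = -∑ ℓ ∈ s, b ℓ j • h ℓ)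
    (hu : ∀ ℓ ∈ s, ‖∑ j, starRingEnd 𝕜 (b ℓ j) • u j‖ < 1) (hh : ∃ ℓ ∈ s, h ℓ ≠ 0) :
    -∑ j, RCLike.re ⟪u j, r j⟫_𝕜 < ∑ ℓ ∈ s, ‖h ℓ‖ := by
  have hsum : -∑ j, RCLike.re ⟪u j, r j⟫_𝕜
      = ∑ ℓ ∈ s, RCLike.re ⟪∑ j, starRingEnd 𝕜 (b ℓ j) • u j, h ℓ⟫_𝕜 := by
    simp only [hr, inner_neg_right, inner_sum, inner_smul_right, sum_inner, inner_smul_left,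
      RCLike.conj_conj, map_neg, map_sum, Finset.sum_neg_distrib, neg_neg]
    exact Finset.sum_comm
  have hle (ℓ : ι) : RCLike.re ⟪∑ j, starRingEnd 𝕜 (b ℓ j) • u j, h ℓ⟫_𝕜
      ≤ ‖∑ j, starRingEnd 𝕜 (b ℓ j) • u j‖ * ‖h ℓ‖ := re_inner_le_norm _ _
  obtain ⟨ℓ₀, hℓ₀, hne⟩ := hh
  rw [hsum]
  exact Finset.sum_lt_sum
    (fun ℓ hℓ => (hle ℓ).trans (mul_le_of_le_one_left (norm_nonneg _) (hu ℓ hℓ).le))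
    ⟨ℓ₀, hℓ₀, (hle ℓ₀).trans_lt (mul_lt_of_lt_one_left (norm_pos_iff.2 hne) (hu ℓ₀ hℓ₀))⟩

variable [NormedSpace ℝ E] [IsScalarTower ℝ 𝕜 E]

lemma re_inner_normalize_self (v : E) :
    RCLike.re ⟪NormedSpace.normalize v, v⟫_𝕜 = ‖v‖ := by
  rw [NormedSpace.normalize, RCLike.real_smul_eq_coe_smul (K := 𝕜), inner_smul_left,
    RCLike.conj_ofReal, RCLike.re_ofReal_mul, inner_self_eq_norm_sq, sq]
  rcases eq_or_ne ‖v‖ 0 with hv | hv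
  · simp [hv]
  · exact inv_mul_cancel_left₀ hv ‖v‖

lemma norm_add_re_inner_normalize_le (v h : E) :
    ‖v‖ + RCLike.re ⟪NormedSpace.normalize v, h⟫_𝕜 ≤ ‖v + h‖ := by
  rw [← re_inner_normalize_self (𝕜 := 𝕜) v, ← map_add, ← inner_add_right]
  exact (re_inner_le_norm _ _).trans
    (mul_le_of_le_one_left (norm_nonneg _) (norm_normalize_le_one v))

end DualCertificate

section Recovery

lemma pinv_mul_self {m κ : Type*} [Fintype m] [Fintype κ] [DecidableEq κ] {B : Matrix m κ ℂ}
    (hB : LinearIndependent ℂ B.col) : pinv B * B = 1 := by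
  open scoped ComplexOrder in
  rw [pinv, Matrix.mul_assoc]
  exact Matrix.nonsing_inv_mul _ ((Matrix.isUnit_iff_isUnit_det _).1
    (Matrix.PosDef.conjTranspose_mul_self B (Matrix.mulVec_injective_iff.2 hB)).isUnit)

variable {n N L : ℕ} {A : Matrix (Fin n) (Fin N) ℂ} {S : Finset (Fin N)}

lemma row_eq_neg_sum_of_mul_eq_zero (hA : LinearIndependent ℂ (colSubmatrix A S).col)
    {H : Matrix (Fin N) (Fin L) ℂ} (hH : A * H = 0) (j : S) :
    H j = -∑ ℓ ∈ Sᶜ, (pinv (colSubmatrix A S)).mulVec (A.col ℓ) j • H ℓ := by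
  ext l
  have hsum : ∑ ℓ, (pinv (colSubmatrix A S) * A) j ℓ * H ℓ l = 0 := by
    rw [← Matrix.mul_apply, Matrix.mul_assoc, hH, Matrix.mul_zero, Matrix.zero_apply]
  have hS (i : S) : (pinv (colSubmatrix A S) * A) j i = (1 : Matrix S S ℂ) j i := by
    rw [← pinv_mul_self hA]
    rfl
  rw [← Finset.sum_add_sum_compl S, ← Finset.sum_coe_sort S] at hsum
  simp only [hS, Matrix.one_apply, ite_mul, one_mul, zero_mul, Finset.sum_ite_eq,
    Finset.mem_univ, if_true] at hsum
  rw [eq_neg_of_add_eq_zero_left hsum]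
  simp only [Pi.neg_apply, Finset.sum_apply, Pi.smul_apply, smul_eq_mul]
  rfl

lemma eq_zero_of_mul_eq_zero (hA : LinearIndependent ℂ (colSubmatrix A S).col)
    {H : Matrix (Fin N) (Fin L) ℂ} (hH : A * H = 0) (hrows : ∀ ℓ ∉ S, H ℓ = 0) : H = 0 := by
  funext i
  by_cases hi : i ∈ S
  · rw [row_eq_neg_sum_of_mul_eq_zero hA hH ⟨i, hi⟩, Finset.sum_eq_zero fun ℓ hℓ => ?_, neg_zero]
    · rfl
    · rw [hrows ℓ (Finset.mem_compl.1 hℓ), smul_zero]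
  · exact hrows i hi

lemma extendRows_apply_mem (M : Matrix S (Fin L) ℂ) (j : S) : extendRows S M j = M j := by
  ext l
  simp [extendRows]

lemma extendRows_apply_notMem (M : Matrix S (Fin L) ℂ) {i : Fin N} (hi : i ∉ S) :
    extendRows S M i = 0 := by
  ext l
  simp [extendRows, hi]

lemma norm21_extendRows_add (M : Matrix S (Fin L) ℂ) (H : Matrix (Fin N) (Fin L) ℂ) :
    norm21 (extendRows S M + H)
      = ∑ j : S, ‖WithLp.toLp 2 (M j) + WithLp.toLp 2 (H j)‖
        + ∑ ℓ ∈ Sᶜ, ‖WithLp.toLp 2 (H ℓ)‖ := by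
  rw [norm21, ← Finset.sum_add_sum_compl S, ← Finset.sum_coe_sort S]
  congr 1
  · refine Finset.sum_congr rfl fun j _ => ?_
    rw [← WithLp.toLp_add, ← extendRows_apply_mem M j]
    rfl
  · refine Finset.sum_congr rfl fun ℓ hℓ => ?_
    rw [← zero_add (H ℓ), ← extendRows_apply_notMem M (Finset.mem_compl.1 hℓ)]
    rfl

lemma norm21_extendRows (M : Matrix S (Fin L) ℂ) :
    norm21 (extendRows S M) = ∑ j : S, ‖WithLp.toLp 2 (M j)‖ := by
  have hadd := norm21_extendRows_add M 0
  have hzero (i : Fin N) : (0 : Matrix (Fin N) (Fin L) ℂ) i = 0 := rfl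
  simpa only [add_zero, hzero, WithLp.toLp_zero, norm_zero, Finset.sum_const_zero] using hadd

lemma norm21_extendRows_lt (hA : LinearIndependent ℂ (colSubmatrix A S).col)
    {M : Matrix S (Fin L) ℂ}
    (hM : ∀ ℓ ∉ S, ‖∑ j : S, starRingEnd ℂ ((pinv (colSubmatrix A S)).mulVec (A.col ℓ) j) •
      NormedSpace.normalize (WithLp.toLp 2 (M j))‖ < 1)
    {H : Matrix (Fin N) (Fin L) ℂ} (hH : A * H = 0) (hH0 : H ≠ 0) :
    norm21 (extendRows S M) < norm21 (extendRows S M + H) := by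
  have hrow (j : S) : WithLp.toLp 2 (H j)
      = -∑ ℓ ∈ Sᶜ, (pinv (colSubmatrix A S)).mulVec (A.col ℓ) j • WithLp.toLp 2 (H ℓ) := by
    rw [row_eq_neg_sum_of_mul_eq_zero hA hH j, WithLp.toLp_neg, WithLp.toLp_sum]
    rfl
  have hne : ∃ ℓ ∈ Sᶜ, WithLp.toLp 2 (H ℓ) ≠ 0 := by
    by_contra! hzero
    exact hH0 (eq_zero_of_mul_eq_zero hA hH fun ℓ hℓ =>
      (WithLp.toLp_eq_zero 2).1 (hzero ℓ (Finset.mem_compl.2 hℓ)))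
  have hcert := neg_sum_re_inner_lt_sum_norm (𝕜 := ℂ) hrow
    (fun ℓ hℓ => hM ℓ (Finset.mem_compl.1 hℓ)) hne
  have hsupport := Finset.sum_le_sum (s := Finset.univ) fun (j : S) _ =>
    norm_add_re_inner_normalize_le (𝕜 := ℂ) (WithLp.toLp 2 (M j)) (WithLp.toLp 2 (H j))
  rw [Finset.sum_add_distrib] at hsupport
  rw [norm21_extendRows, norm21_extendRows_add]
  linarith

lemma l21Recovers_of_norm21_lt {X : Matrix (Fin N) (Fin L) ℂ}
    (hX : ∀ H : Matrix (Fin N) (Fin L) ℂ, A * H = 0 → H ≠ 0 → norm21 X < norm21 (X + H)) :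
    L21Recovers A X := by
  have hlt (Z : Matrix (Fin N) (Fin L) ℂ) (hZ : A * Z = A * X) (hne : Z ≠ X) :
      norm21 X < norm21 Z := by
    simpa only [add_sub_cancel] using
      hX (Z - X) (by rw [Matrix.mul_sub, hZ, sub_self]) (sub_ne_zero.2 hne)
  refine fun Z => ⟨fun hZ => by_contra fun hne => (hlt Z hZ.1 hne).not_ge (hZ.2 X rfl), ?_⟩
  rintro rfl
  refine ⟨rfl, fun Z' hZ' => ?_⟩
  rcases eq_or_ne Z' Z with rfl | hne
  · rfl
  · exact (hlt Z' hZ' hne).le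

end Recovery

section Models

section Sphere

open scoped Pointwise

variable {V : Type*} [NormedAddCommGroup V] [InnerProductSpace ℝ V]

lemma smul_preimage_linearIsometryEquiv (e : V ≃ₗᵢ[ℝ] V) (t : Set ℝ) (s : Set V) :
    t • (e ⁻¹' s) = e ⁻¹' (t • s) := by
  have himage (u : Set V) : e ⁻¹' u = e.symm '' u := (e.symm.image_eq_preimage_symm u).symm
  rw [himage, himage]
  exact (Set.image_image2_distrib_right fun r v => map_smul e.symm r v).symm

variable [FiniteDimensional ℝ V] [MeasurableSpace V] [BorelSpace V]

lemma uniformSphere_apply {s : Set V} (hs : MeasurableSet s) :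
    uniformSphere V s = ((volume : Measure V).toSphere Set.univ)⁻¹ *
      (Module.finrank ℝ V * volume (Set.Ioo (0 : ℝ) 1 • (Metric.sphere (0 : V) 1 ∩ s))) := by
  rw [uniformSphere, Measure.map_apply measurable_subtype_coe hs, Measure.smul_apply, smul_eq_mul,
    Measure.toSphere_apply' _ (measurable_subtype_coe hs), Subtype.image_preimage_coe]

lemma isRotationInvariant_uniformSphere : IsRotationInvariant (uniformSphere V) := by
  intro e
  ext s hs
  have hcone : Set.Ioo (0 : ℝ) 1 • (Metric.sphere (0 : V) 1 ∩ e ⁻¹' s)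
      = e ⁻¹' (Set.Ioo (0 : ℝ) 1 • (Metric.sphere (0 : V) 1 ∩ s)) := by
    rw [← smul_preimage_linearIsometryEquiv, Set.preimage_inter, e.preimage_sphere, map_zero]
  rw [Measure.map_apply e.continuous.measurable hs,
    uniformSphere_apply (e.continuous.measurable hs), uniformSphere_apply hs, hcone,
    e.measurePreserving.measure_preimage_emb e.toHomeomorph.measurableEmbedding]

end Sphere

variable {Ω : Type*} [MeasurableSpace Ω] {μ : Measure Ω} {κ : Type*}

lemma iIndepFun_curry [Countable κ] {ι : Type*} [Countable ι] {𝓧 : Type*} [MeasurableSpace 𝓧]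
    {X : κ × ι → Ω → 𝓧} (hX : ∀ p, AEMeasurable (X p) μ) (h : iIndepFun X μ) :
    iIndepFun (fun j ω i => X (j, i) ω) μ := by
  have := h.isProbabilityMeasure
  have hp (p) : IsProbabilityMeasure (μ.map (X p)) := Measure.isProbabilityMeasure_map (hX p)
  have hrow (j : κ) : AEMeasurable (fun ω i => X (j, i) ω) μ :=
    aemeasurable_pi_lambda _ fun i => hX (j, i)
  have hrows (j : κ) : μ.map (fun ω i => X (j, i) ω)
      = Measure.infinitePi fun i => μ.map (X (j, i)) :=
    (h.precomp (g := fun i : ι => (j, i)) (Prod.mk_right_injective j)).map_fun_eq_infinitePi_map₀'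
      fun i => hX (j, i)
  rw [iIndepFun_iff_map_fun_eq_infinitePi_map₀' hrow]
  simp_rw [hrows]
  rw [← Measure.infinitePi_map_curry (fun j i => μ.map (X (j, i))),
    ← h.map_fun_eq_infinitePi_map₀' hX,
    AEMeasurable.map_map_of_aemeasurable (MeasurableEquiv.measurable _).aemeasurable
      (aemeasurable_pi_lambda _ hX)]
  rfl

section Gaussian

variable {V : Type*} [NormedAddCommGroup V] [InnerProductSpace ℝ V] [FiniteDimensional ℝ V]
  [MeasurableSpace V] [BorelSpace V]

lemma map_sum_smul_orthonormalBasis_eq_stdGaussian {ι : Type*} [Fintype ι]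
    (B : OrthonormalBasis ι ℝ V) {X : ι → Ω → ℝ} (hX : ∀ i, HasLaw (X i) (gaussianReal 0 1) μ)
    (h : iIndepFun X μ) :
    μ.map (fun ω => ∑ i, X i ω • B i) = stdGaussian V := by
  have hpi : μ.map (fun ω i => X i ω) = Measure.pi fun _ => gaussianReal 0 1 := by
    simpa only [fun i => (hX i).map_eq] using h.map_fun_eq_pi_map fun i => (hX i).aemeasurable
  rw [stdGaussian_eq_map_pi_orthonormalBasis B, ← hpi, AEMeasurable.map_map_of_aemeasurable
    (Measurable.aemeasurable (by fun_prop))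
    (aemeasurable_pi_lambda _ fun i => (hX i).aemeasurable)]
  rfl

lemma isRotationInvariantFamily_sum_smul_orthonormalBasis [Countable κ] {ι : Type*} [Fintype ι]
    (B : OrthonormalBasis ι ℝ V) {X : κ × ι → Ω → ℝ}
    (hX : ∀ p, HasLaw (X p) (gaussianReal 0 1) μ) (h : iIndepFun X μ) :
    IsRotationInvariantFamily (fun j ω => ∑ i, X (j, i) ω • B i) μ where
  aemeasurable j := Finset.aemeasurable_fun_sum _ fun i _ =>
    (hX (j, i)).aemeasurable.smul_const _
  indep := (iIndepFun_curry (fun p => (hX p).aemeasurable) h).comp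
    (fun _ x => ∑ i, x i • B i) fun _ => by fun_prop
  invariant j := by
    rw [map_sum_smul_orthonormalBasis_eq_stdGaussian B (fun i => hX (j, i))
      (h.precomp (Prod.mk_right_injective j))]
    exact stdGaussian_map

end Gaussian

variable {L : ℕ}

lemma IsRealGaussian.isRotationInvariantFamily [Countable κ]
    {Φ : Ω → Matrix κ (Fin L) ℝ} (h : IsRealGaussian Φ μ) :
    IsRotationInvariantFamily (fun j ω => WithLp.toLp 2 (Φ ω j)) μ := by
  convert isRotationInvariantFamily_sum_smul_orthonormalBasis
    (EuclideanSpace.basisFun (Fin L) ℝ) h.1 h.2 using 3 with j ω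
  exact ((EuclideanSpace.basisFun (Fin L) ℝ).sum_repr _).symm

lemma IsRealSpherical.isRotationInvariantFamily
    {Φ : Ω → Matrix κ (Fin L) ℝ} (h : IsRealSpherical Φ μ) :
    IsRotationInvariantFamily (fun j ω => WithLp.toLp 2 (Φ ω j)) μ where
  aemeasurable j := (h.1 j).aemeasurable
  indep := h.2
  invariant j := (h.1 j).map_eq ▸ isRotationInvariant_uniformSphere

lemma IsComplexGaussian.isRotationInvariantFamily [Countable κ]
    {Φ : Ω → Matrix κ (Fin L) ℂ} (h : IsComplexGaussian Φ μ) :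
    IsRotationInvariantFamily (fun j ω => WithLp.toLp 2 (Φ ω j)) μ := by
  let B : OrthonormalBasis ((_ : Fin L) × Fin 2) ℝ (EuclideanSpace ℂ (Fin L)) :=
    Pi.orthonormalBasis fun _ => Complex.orthonormalBasisOneI
  let entry : κ × ((_ : Fin L) × Fin 2) → (κ × Fin L) ⊕ (κ × Fin L) := fun p =>
    if p.2.2 = 0 then Sum.inl (p.1, p.2.1) else Sum.inr (p.1, p.2.1)
  have hentry : Function.Injective entry := by
    rintro ⟨j, l, a⟩ ⟨j', l', a'⟩ hp
    fin_cases a <;> fin_cases a' <;> simp_all [entry]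
  have hlaw (p : (κ × Fin L) ⊕ (κ × Fin L)) :
      HasLaw (Sum.elim (fun (p : κ × Fin L) ω => (Φ ω p.1 p.2).re)
        (fun (p : κ × Fin L) ω => (Φ ω p.1 p.2).im) p) (gaussianReal 0 1) μ :=
    p.rec (fun p => (h.1 p).1) fun p => (h.1 p).2
  convert isRotationInvariantFamily_sum_smul_orthonormalBasis B (fun p => hlaw (entry p))
    (h.2.precomp hentry) using 3 with j ω
  rw [← B.sum_repr (WithLp.toLp 2 (Φ ω j))]
  refine Finset.sum_congr rfl ?_
  rintro ⟨l, a⟩ -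
  congr 1
  fin_cases a <;> simp [B, entry, Pi.orthonormalBasis_repr]

lemma IsComplexSpherical.isRotationInvariantFamily
    {Φ : Ω → Matrix κ (Fin L) ℂ} (h : IsComplexSpherical Φ μ) :
    IsRotationInvariantFamily (fun j ω => WithLp.toLp 2 (Φ ω j)) μ where
  aemeasurable j := (h.1 j).aemeasurable
  indep := h.2
  invariant j := (h.1 j).map_eq ▸ isRotationInvariant_uniformSphere

end Models

section RecoveryProbability

lemma normalize_row_diagonal_mul {κ ι : Type*} [Fintype κ] [DecidableEq κ] [Fintype ι] {σ : κ → ℝ}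
    {j : κ} (hσ : 0 < σ j) (M : Matrix κ ι ℂ) :
    NormedSpace.normalize (WithLp.toLp 2 ((Matrix.diagonal (fun j => (σ j : ℂ)) * M) j))
      = NormedSpace.normalize (WithLp.toLp 2 (M j)) := by
  rw [← NormedSpace.normalize_smul_of_pos hσ (WithLp.toLp 2 (M j))]
  congr 1
  ext l
  simp [Matrix.diagonal_mul]

lemma normalize_row_diagonal_mul_map_ofReal {κ ι : Type*} [Fintype κ] [DecidableEq κ] [Fintype ι]
    {σ : κ → ℝ} {j : κ} (hσ : 0 < σ j) (M : Matrix κ ι ℝ) :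
    NormedSpace.normalize
        (WithLp.toLp 2 ((Matrix.diagonal σ * M).map (fun x : ℝ => (x : ℂ)) j))
      = euclideanOfReal ι (NormedSpace.normalize (WithLp.toLp 2 (M j))) := by
  rw [← normalize_linearIsometry,
    ← NormedSpace.normalize_smul_of_pos hσ (euclideanOfReal ι (WithLp.toLp 2 (M j)))]
  congr 1
  ext l
  simp [euclideanOfReal, Matrix.diagonal_mul]

variable {Ω : Type*} [MeasurableSpace Ω] {μ : Measure Ω} [IsProbabilityMeasure μ]

lemma one_sub_card_mul_le_measureReal {ι : Type*} {s : Finset ι} {good : Set Ω}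
    {bad : ι → Set Ω} {ε : ℝ} (hbad : ∀ ℓ ∈ s, μ.real (bad ℓ) ≤ ε)
    (hgood : ∀ᵐ ω ∂μ, (∀ ℓ ∈ s, ω ∉ bad ℓ) → ω ∈ good) :
    1 - s.card * ε ≤ μ.real good := by
  have hcover : ∀ᵐ ω ∂μ, ω ∈ good ∪ ⋃ ℓ ∈ s, bad ℓ := by
    filter_upwards [hgood] with ω hω
    by_contra! hcon
    simp only [Set.mem_union, Set.mem_iUnion, not_or, not_exists] at hcon
    exact hcon.1 (hω hcon.2)
  have hsum : μ.real (⋃ ℓ ∈ s, bad ℓ) ≤ s.card * ε := by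
    calc μ.real (⋃ ℓ ∈ s, bad ℓ) ≤ ∑ ℓ ∈ s, μ.real (bad ℓ) := measureReal_biUnion_finset_le _ _
      _ ≤ s.card * ε := (Finset.sum_le_card_nsmul _ _ _ hbad).trans_eq (nsmul_eq_mul _ _)
  have hone : 1 ≤ μ.real good + μ.real (⋃ ℓ ∈ s, bad ℓ) := by
    calc 1 = μ.real Set.univ := probReal_univ.symm
      _ ≤ μ.real (good ∪ ⋃ ℓ ∈ s, bad ℓ) :=
        ENNReal.toReal_mono (measure_ne_top _ _) (measure_mono_ae (hcover.mono fun _ h _ => h))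
      _ ≤ _ := measureReal_union_le _ _
  linarith

lemma one_sub_mul_le_measureReal_l21Recovers {n N L : ℕ} {A : Matrix (Fin n) (Fin N) ℂ}
    {S : Finset (Fin N)} (hA : LinearIndependent ℂ (colSubmatrix A S).col) {α ε : ℝ}
    (hα : ∀ ℓ ∉ S, ‖WithLp.toLp 2 ((pinv (colSubmatrix A S)).mulVec (A.col ℓ))‖ ≤ α) (hε : 0 ≤ ε)
    {M : Ω → Matrix S (Fin L) ℂ} {u : Ω → S → EuclideanSpace ℂ (Fin L)}
    (hu : ∀ᵐ ω ∂μ, ∀ j, NormedSpace.normalize (WithLp.toLp 2 (M ω j)) = u ω j)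
    (htail : ∀ b : S → ℂ, ∑ j, ‖b j‖ ^ 2 ≤ α ^ 2 → μ.real {ω | 1 ≤ ‖∑ j, b j • u ω j‖} ≤ ε) :
    1 - N * ε ≤ μ.real {ω | L21Recovers A (extendRows S (M ω))} := by
  have hb (ℓ : Fin N) (hℓ : ℓ ∈ Sᶜ) :
      ∑ j, ‖starRingEnd ℂ ((pinv (colSubmatrix A S)).mulVec (A.col ℓ) j)‖ ^ 2 ≤ α ^ 2 := by
    simpa only [RCLike.norm_conj, EuclideanSpace.norm_sq_eq] using
      pow_le_pow_left₀ (norm_nonneg _) (hα ℓ (Finset.mem_compl.1 hℓ)) 2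
  have hcard : ((Sᶜ).card : ℝ) ≤ N := mod_cast card_finset_fin_le _
  refine le_trans (by gcongr) (one_sub_card_mul_le_measureReal (fun ℓ hℓ => htail _ (hb ℓ hℓ)) ?_)
  filter_upwards [hu] with ω hω hgood
  refine l21Recovers_of_norm21_lt fun H => norm21_extendRows_lt hA fun ℓ hℓ => ?_
  simpa only [hω, Set.mem_ofPred_eq, not_le] using hgood ℓ (Finset.mem_compl.2 hℓ)

end RecoveryProbability

theorem mainTheorem1_general {Ω : Type*} [MeasurableSpace Ω] (μ : Measure Ω)
    [IsProbabilityMeasure μ] {n N L : ℕ} (A : Matrix (Fin n) (Fin N) ℂ) (S : Finset (Fin N))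
    (hA : LinearIndependent ℂ (colSubmatrix A S).col)
    (α : ℝ) (hα0 : 0 < α) (hα1 : α < 1)
    (hα : ∀ ℓ : Fin N, ℓ ∉ S →
      ‖WithLp.toLp 2 ((pinv (colSubmatrix A S)).mulVec (A.col ℓ))‖ ≤ α)
    (σ : Ω → S → ℝ) (hσ : ∀ᵐ ω ∂μ, ∀ j, 0 < σ ω j) :
    (∀ Φ : Ω → Matrix S (Fin L) ℝ,
      IsRotationInvariantFamily (fun j ω => WithLp.toLp 2 (Φ ω j)) μ →
      1 - (N : ℝ) * Real.exp (-((L : ℝ) / 2) * ((α ^ 2)⁻¹ - Real.log ((α ^ 2)⁻¹) - 1)) ≤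
        μ.real {ω | L21Recovers A
          (extendRows S ((Matrix.diagonal (σ ω) * Φ ω).map (fun x : ℝ => (x : ℂ))))}) ∧
    (∀ Φ : Ω → Matrix S (Fin L) ℂ,
      IsRotationInvariantFamily (fun j ω => WithLp.toLp 2 (Φ ω j)) μ →
      1 - (N : ℝ) * Real.exp (-(L : ℝ) * ((α ^ 2)⁻¹ - Real.log ((α ^ 2)⁻¹) - 1)) ≤
        μ.real {ω | L21Recovers A
          (extendRows S (Matrix.diagonal (fun j => (σ ω j : ℂ)) * Φ ω))}) := by
  refine ⟨fun Φ hΦ => ?_, fun Φ hΦ => ?_⟩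
  · refine one_sub_mul_le_measureReal_l21Recovers hA hα (Real.exp_pos _).le
      (hσ.mono fun ω hω j => normalize_row_diagonal_mul_map_ofReal (hω j) (Φ ω)) fun b hb => ?_
    simpa only [Fintype.card_fin] using
      hΦ.measureReal_one_le_norm_sum_smul_euclideanOfReal_normalize_le hα0 hα1 hb
  · refine one_sub_mul_le_measureReal_l21Recovers hA hα (Real.exp_pos _).le
      (hσ.mono fun ω hω j => normalize_row_diagonal_mul (hω j) (Φ ω)) fun b hb => ?_
    have hfinrank : (Module.finrank ℝ (EuclideanSpace ℂ (Fin L)) : ℝ) / 2 = L := by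
      rw [finrank_real_of_complex, finrank_euclideanSpace_fin]
      push_cast
      ring
    simpa only [hfinrank] using
      hΦ.measureReal_one_le_norm_sum_smul_normalize_le hα0 hα1 hb

theorem mainTheorem1 {Ω : Type*} [MeasurableSpace Ω] (μ : Measure Ω) [IsProbabilityMeasure μ]
    {n N L : ℕ} (A : Matrix (Fin n) (Fin N) ℂ) (S : Finset (Fin N))
    (hA : LinearIndependent ℂ (colSubmatrix A S).col)
    (α : ℝ) (hα0 : 0 < α) (hα1 : α < 1)
    (hα : ∀ ℓ : Fin N, ℓ ∉ S →
      ‖WithLp.toLp 2 ((pinv (colSubmatrix A S)).mulVec (A.col ℓ))‖ ≤ α)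
    (σ : Ω → S → ℝ) (hσm : ∀ j, AEMeasurable (fun ω => σ ω j) μ)
    (hσ : ∀ᵐ ω ∂μ, ∀ j, 0 < σ ω j) :
    (∀ Φ : Ω → Matrix S (Fin L) ℝ, IsRealGaussian Φ μ ∨ IsRealSpherical Φ μ →
      1 - (N : ℝ) * Real.exp (-((L : ℝ) / 2) * ((α ^ 2)⁻¹ - Real.log ((α ^ 2)⁻¹) - 1)) ≤
        μ.real {ω | L21Recovers A
          (extendRows S ((Matrix.diagonal (σ ω) * Φ ω).map (fun x : ℝ => (x : ℂ))))}) ∧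
    (∀ Φ : Ω → Matrix S (Fin L) ℂ, IsComplexGaussian Φ μ ∨ IsComplexSpherical Φ μ →
      1 - (N : ℝ) * Real.exp (-(L : ℝ) * ((α ^ 2)⁻¹ - Real.log ((α ^ 2)⁻¹) - 1)) ≤
        μ.real {ω | L21Recovers A
          (extendRows S (Matrix.diagonal (fun j => (σ ω j : ℂ)) * Φ ω))}) := by
  have hgen := mainTheorem1_general (L := L) μ A S hA α hα0 hα1 hα σ hσ
  exact ⟨fun Φ hΦ => hgen.1 Φ (hΦ.elim (·.isRotationInvariantFamily) (·.isRotationInvariantFamily)),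
    fun Φ hΦ => hgen.2 Φ (hΦ.elim (·.isRotationInvariantFamily) (·.isRotationInvariantFamily))⟩
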